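/- \textbf{Setting.} An agent has a private ability $\theta$ with distribution $F$ on $\Theta=[\underline\theta,\bar\theta]$, $\underline\theta<\bar\theta$, which has a continuous density $f>0$ on $\Theta$. He chooses a quality $q\in Q=[0,q_{\max}]$, $q_{\max}>0$, at cost $c(q,\theta)$, where $c$ is real-valued and twice continuously differentiable on $Q\times\Theta$ with $c_q(q,\theta)>0$ and $c_{q\theta}(q,\theta)<0$ for all $q\in Q$ with $q>0$ and all $\theta\in\Theta$. A direct mechanism $(q,w)$ consists of a (measurable) quality function $q\colon\Theta\to Q$ and an interim wage function $w\colon\Theta\to[\underline\theta,\bar\theta]$. It is \emph{incentive compatible} if $w(\theta)-c(q(\theta),\theta)\ge w(\theta')-c(q(\theta'),\theta)$ for all $\theta,\theta'\in\Theta$. A \emph{rating scheme} is a Markov kernel $\pi\colon Q\to\Delta(S)$ into a measurable space $S$ of scores. The market values ability: after score $s$ it holds a belief $\mu_s\in\Delta(\Theta)$ (measurable in $s$) and pays $\omega(s)=\mathbb E_{\mu_s}[\theta]$, where the beliefs obey Bayes' rule, that is, $\mu$ is a regular conditional distribution of $\theta$ given $s$ when $\theta\sim F$ and $s\mid\theta\sim\pi(q(\theta))$.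 The mechanism $(q,w)$ is \emph{feasible} if there are a rating scheme $\pi$ and such beliefs with $$w(\theta)=\mathbb E_{s\sim\pi(q(\theta))}[\omega(s)]\qquad\text{for all }\theta\in\Theta .$$ \textbf{Theorem.} An incentive-compatible direct mechanism $(q,w)$ is feasible if and only if $w(\theta)$ is a mean-preserving spread of $\theta$ in the quantile space, that is, \begin{enumerate} \item[(MPS$'$)] $\displaystyle\int_{\underline\theta}^{\theta}w(\theta')\,dF(\theta')\ \ge\ \int_{\underline\theta}^{\theta}\theta'\,dF(\theta')$ for all $\theta\in\Theta$, and \item[(BP$'$)] $\displaystyle\int_{\underline\theta}^{\bar\theta}w(\theta)\,dF(\theta)\ =\ \int_{\underline\theta}^{\bar\theta}\theta\,dF(\theta)$. \end{enumerate} -/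

import Mathlib

open MeasureTheory ProbabilityTheory

namespace AbilitySignaling

/-- The primitives of the model: the ability interval `[lo, hi]`, the quality interval `[0, qmax]`,
a continuous and strictly positive probability density `f` of abilities, and a twice continuously
differentiable cost function `c q θ` whose partial derivatives satisfy `c_q > 0` and `c_{qθ} < 0`
at every quality `q > 0` (one-sided derivatives at the ends of the intervals). -/
structure Env where
  lo : ℝ
  hi : ℝ
  lo_lt_hi : lo < hi
  qmax : ℝ
  qmax_pos : 0 < qmax
  f : ℝ → ℝ
  f_continuousOn : ContinuousOn f (Set.Icc lo hi)
  f_pos : ∀ θ ∈ Set.Icc lo hi, 0 < f θ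
  f_integral : ∫ θ in Set.Icc lo hi, f θ = 1
  c : ℝ → ℝ → ℝ
  c_contDiff : ContDiffOn ℝ 2 (Function.uncurry c) (Set.Icc 0 qmax ×ˢ Set.Icc lo hi)
  c_q_pos : ∀ q ∈ Set.Icc 0 qmax, 0 < q → ∀ θ ∈ Set.Icc lo hi,
    0 < derivWithin (fun x => c x θ) (Set.Icc 0 qmax) q
  c_qθ_neg : ∀ q ∈ Set.Icc 0 qmax, 0 < q → ∀ θ ∈ Set.Icc lo hi,
    derivWithin (fun t => derivWithin (fun x => c x t) (Set.Icc 0 qmax) q) (Set.Icc lo hi) θ < 0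

/-- The type space `Θ = [lo, hi]`. -/
abbrev Env.Ability (E : Env) : Type := Set.Icc E.lo E.hi

/-- The quality space `Q = [0, qmax]`. -/
abbrev Env.Quality (E : Env) : Type := Set.Icc (0 : ℝ) E.qmax

/-- The distribution `F` of abilities, with density `f` with respect to Lebesgue measure. -/
noncomputable def Env.F (E : Env) : Measure E.Ability :=
  (Measure.comap (Subtype.val : E.Ability → ℝ) volume).withDensity (fun θ => ENNReal.ofReal (E.f θ))

/-- A direct mechanism: a quality function `q : Θ → Q` and an interim wage function `w`. Wages are
expected abilities, so `w` takes values in `[lo, hi]`. -/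
structure DirectMechanism (E : Env) where
  q : E.Ability → E.Quality
  measurable_q : Measurable q
  w : E.Ability → ℝ
  w_mem : ∀ θ, w θ ∈ Set.Icc E.lo E.hi

/-- Incentive compatibility: no type `θ` gains by reporting another type `θ'`. -/
def DirectMechanism.IncentiveCompatible {E : Env} (m : DirectMechanism E) : Prop :=
  ∀ θ θ' : E.Ability, m.w θ - E.c (m.q θ) θ ≥ m.w θ' - E.c (m.q θ') θ

/-- The distribution of the score conditional on the ability, when every type `θ` chooses the
quality `q(θ)` and the score is drawn from `π (q(θ))`. -/
noncomputable def DirectMechanism.scoreKernel {E : Env} (m : DirectMechanism E)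
    {S : Type} [MeasurableSpace S] (π : Kernel E.Quality S) : Kernel E.Ability S :=
  π.comap m.q m.measurable_q

/-- The market's beliefs about the ability (`belief s` after score `s`) obey Bayes' rule: the joint
law of (score, ability) is the law of the score followed by the beliefs. -/
def DirectMechanism.BayesConsistent {E : Env} (m : DirectMechanism E)
    {S : Type} [MeasurableSpace S] (π : Kernel E.Quality S) (belief : Kernel S E.Ability) : Prop :=
  (E.F.compProd (m.scoreKernel π)).map Prod.swap =
    (E.F.bind (m.scoreKernel π)).compProd belief

/-- The wage `ω(s) = E[θ | s]` that the market offers after score `s`. -/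
noncomputable def marketWage {E : Env} {S : Type} [MeasurableSpace S]
    (belief : Kernel S E.Ability) (s : S) : ℝ :=
  ∫ θ, (θ : ℝ) ∂(belief s)

/-- The mechanism is feasible: some rating scheme `π : Q → Δ(S)`, with market beliefs given by
Bayes' rule, induces the interim wage `w(θ) = E_{s ∼ π(q(θ))} [E[θ | s]]` of every type. -/
def DirectMechanism.Feasible {E : Env} (m : DirectMechanism E) : Prop :=
  ∃ (S : Type) (_ : MeasurableSpace S) (π : Kernel E.Quality S) (belief : Kernel S E.Ability),
    IsMarkovKernel π ∧ IsMarkovKernel belief ∧ m.BayesConsistent π belief ∧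
      ∀ θ, m.w θ = ∫ s, marketWage belief s ∂(π (m.q θ))

/-- The mean-preserving-spread inequalities in the quantile space. -/
def DirectMechanism.MPS {E : Env} (m : DirectMechanism E) : Prop :=
  ∀ θ : E.Ability, ∫ t in Set.Iic θ, m.w t ∂E.F ≥ ∫ t in Set.Iic θ, (t : ℝ) ∂E.F

/-- Bayesian plausibility: the expected wage equals the expected ability. -/
def DirectMechanism.BP {E : Env} (m : DirectMechanism E) : Prop :=
  ∫ t, m.w t ∂E.F = ∫ t, (t : ℝ) ∂E.F

end AbilitySignaling

/-! Necessity holds score by score. Under any belief, ability and the event {θ ≤ a} are negatively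
associated, so E[θ; θ ≤ a] is at most the posterior mean times P(θ ≤ a). Averaging over scores and
applying Bayes' rule turns the two sides into the two integrals of (MPS'); the sure event gives
(BP').

For sufficiency, incentive compatibility and single crossing make the wage a monotone function W of
quality. Let G be the law of quality and X = E[θ | q]. The two conditions then say that ∫ (X - W) h
dG ≥ 0 for every bounded monotone h (`integral_sub_mul_nonneg`). What is needed is a random score s
with E[s | q] = W and E[X | s] = s. Both demands are linear in the joint law of (q, X, s), so the
Riesz extension theorem (`exists_measure_integral_eq`) reduces existence to a positivity check: for
each continuous ψ, some conditional expectation v of X must satisfy ∫ v ψ ≤ ∫ W ψ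
(`Env.exists_score`).

Such a v comes from the L² projection p of -ψ on the closed cone of monotone functions. For
1-Lipschitz k, both p + k(p) and p - k(p) stay in the cone, so -ψ - p is orthogonal to functions of
p. With v = E[X | p] this gives ∫ v(-ψ) = ∫ X p ≥ ∫ W p ≥ ∫ W(-ψ), the content of
`exists_condExp_integral_ge`. -/

namespace AbilitySignaling

/-! ### Single crossing of the cost function -/

section Cost

variable (E : Env)

theorem Env.continuousOn_cost {θ : ℝ} (hθ : θ ∈ Set.Icc E.lo E.hi) :
    ContinuousOn (fun x => E.c x θ) (Set.Icc 0 E.qmax) :=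
  E.c_contDiff.continuousOn.comp (f := fun x => (x, θ))
    (continuousOn_id.prodMk continuousOn_const) fun _ hx => ⟨hx, hθ⟩

/-- `derivWithin` is 0 where the function is not differentiable, so its strict sign already yields
differentiability. -/
theorem Env.hasDerivAt_cost {θ q : ℝ} (hθ : θ ∈ Set.Icc E.lo E.hi) (hq : q ∈ Set.Ioo 0 E.qmax) :
    HasDerivAt (fun x => E.c x θ)
      (derivWithin (fun x => E.c x θ) (Set.Icc 0 E.qmax) q) q :=
  (differentiableWithinAt_of_derivWithin_ne_zero
    (E.c_q_pos q (Set.Ioo_subset_Icc_self hq) hq.1 θ hθ).ne').hasDerivWithinAt.hasDerivAt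
    (Icc_mem_nhds hq.1 hq.2)

theorem Env.strictMonoOn_cost {θ : ℝ} (hθ : θ ∈ Set.Icc E.lo E.hi) :
    StrictMonoOn (fun x => E.c x θ) (Set.Icc 0 E.qmax) := by
  refine strictMonoOn_of_deriv_pos (convex_Icc _ _) (E.continuousOn_cost hθ) fun q hq => ?_
  rw [interior_Icc] at hq
  rw [(E.hasDerivAt_cost hθ hq).deriv]
  exact E.c_q_pos q (Set.Ioo_subset_Icc_self hq) hq.1 θ hθ

theorem Env.strictAntiOn_marginalCost {q : ℝ} (hq : q ∈ Set.Icc 0 E.qmax) (hq0 : 0 < q) :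
    StrictAntiOn (fun t => derivWithin (fun x => E.c x t) (Set.Icc 0 E.qmax) q)
      (Set.Icc E.lo E.hi) := by
  have hd : ∀ θ ∈ Set.Icc E.lo E.hi, DifferentiableWithinAt ℝ
      (fun t => derivWithin (fun x => E.c x t) (Set.Icc 0 E.qmax) q) (Set.Icc E.lo E.hi) θ :=
    fun θ hθ => differentiableWithinAt_of_derivWithin_ne_zero (E.c_qθ_neg q hq hq0 θ hθ).ne
  refine strictAntiOn_of_deriv_neg (convex_Icc _ _)
    (fun θ hθ => (hd θ hθ).continuousWithinAt) fun θ hθ => ?_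
  rw [interior_Icc] at hθ
  have hθ' := Set.Ioo_subset_Icc_self hθ
  rw [((hd θ hθ').hasDerivWithinAt.hasDerivAt (Icc_mem_nhds hθ.1 hθ.2)).deriv]
  exact E.c_qθ_neg q hq hq0 θ hθ'

/-- Strictly decreasing differences: raising the quality is cheaper for abler types. -/
theorem Env.cost_sub_lt {θ₁ θ₂ q₁ q₂ : ℝ} (h₁ : θ₁ ∈ Set.Icc E.lo E.hi)
    (h₂ : θ₂ ∈ Set.Icc E.lo E.hi) (hθ : θ₁ < θ₂) (hq₁ : q₁ ∈ Set.Icc 0 E.qmax)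
    (hq₂ : q₂ ∈ Set.Icc 0 E.qmax) (hq : q₁ < q₂) :
    E.c q₂ θ₂ - E.c q₁ θ₂ < E.c q₂ θ₁ - E.c q₁ θ₁ := by
  have h : StrictMonoOn (fun x => E.c x θ₁ - E.c x θ₂) (Set.Icc 0 E.qmax) := by
    refine strictMonoOn_of_deriv_pos (convex_Icc _ _)
      ((E.continuousOn_cost h₁).sub (E.continuousOn_cost h₂)) fun q hq => ?_
    rw [interior_Icc] at hq
    rw [((E.hasDerivAt_cost h₁ hq).fun_sub (E.hasDerivAt_cost h₂ hq)).deriv, sub_pos]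
    exact E.strictAntiOn_marginalCost (Set.Ioo_subset_Icc_self hq) hq.1 h₁ h₂ hθ
  have := h hq₁ hq₂ hq
  simp only at this
  linarith

end Cost

/-! ### Monotonicity from incentive compatibility -/

section IncentiveCompatible

variable {E : Env} {m : DirectMechanism E}

/-- Adding the incentive constraints of two types cancels the wages; a drop in quality would
contradict decreasing differences. -/
theorem DirectMechanism.IncentiveCompatible.monotone_q (h : m.IncentiveCompatible) :
    Monotone m.q := by
  intro θ θ' hθ
  rcases hθ.eq_or_lt with rfl | hlt
  · exact le_rfl
  by_contra! hq
  have h1 := E.cost_sub_lt θ.2 θ'.2 hlt (m.q θ').2 (m.q θ).2 hq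
  linarith [h θ θ', h θ' θ]

/-- Otherwise θ' would mimic θ: higher pay at no higher cost. In particular equal qualities earn
equal wages. -/
theorem DirectMechanism.IncentiveCompatible.w_le_of_q_le (h : m.IncentiveCompatible)
    {θ θ' : E.Ability} (hq : m.q θ ≤ m.q θ') : m.w θ ≤ m.w θ' := by
  have := (E.strictMonoOn_cost θ'.2).monotoneOn (m.q θ).2 (m.q θ').2 hq
  linarith [h θ' θ]

theorem DirectMechanism.IncentiveCompatible.monotone_w (h : m.IncentiveCompatible) :
    Monotone m.w := fun _ _ hθ => h.w_le_of_q_le (h.monotone_q hθ)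

/-- Under incentive compatibility the wage is a monotone function of the quality. -/
theorem DirectMechanism.IncentiveCompatible.exists_monotone_wage (h : m.IncentiveCompatible) :
    ∃ W : E.Quality → E.Ability, Monotone W ∧ ∀ θ, (W (m.q θ) : ℝ) = m.w θ := by
  have hlo : E.lo ∈ Set.Icc E.lo E.hi := ⟨le_rfl, E.lo_lt_hi.le⟩
  -- The supremum of wages earned at qualities up to x extends the wage to unchosen qualities;
  -- `E.lo` covers those below every chosen one.
  let A : E.Quality → Set ℝ := fun x => insert E.lo (m.w '' {θ | m.q θ ≤ x})
  have hub : ∀ x, ∀ y ∈ A x, y ≤ E.hi := by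
    rintro x y (rfl | ⟨θ, -, rfl⟩)
    exacts [hlo.2, (m.w_mem θ).2]
  have hbdd : ∀ x, BddAbove (A x) := fun x => ⟨_, hub x⟩
  have hne : ∀ x, (A x).Nonempty := fun x => ⟨_, Set.mem_insert _ _⟩
  refine ⟨fun x => ⟨sSup (A x), le_csSup (hbdd x) (Set.mem_insert _ _),
    csSup_le (hne x) (hub x)⟩, ?_, ?_⟩
  · intro x y hxy
    exact csSup_le_csSup (hbdd y) (hne x) (Set.insert_subset_insert
      (Set.image_mono fun θ (hθ : m.q θ ≤ x) => hθ.trans hxy))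
  · intro θ
    refine le_antisymm (csSup_le (hne _) ?_) (le_csSup (hbdd _) (Or.inr ⟨θ, le_refl (m.q θ), rfl⟩))
    rintro y (rfl | ⟨θ', hθ', rfl⟩)
    exacts [(m.w_mem θ).1, h.w_le_of_q_le hθ']

end IncentiveCompatible

/-! ### The ability distribution and Chebyshev's inequality -/

section AbilityDistribution

variable (E : Env)

instance Env.isProbabilityMeasure_F : IsProbabilityMeasure E.F := by
  refine ⟨?_⟩
  rw [Env.F, withDensity_apply _ MeasurableSet.univ, Measure.restrict_univ,
    lintegral_subtype_comap measurableSet_Icc (fun θ => ENNReal.ofReal (E.f θ)),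
    ← ofReal_integral_eq_lintegral_ofReal (E.f_continuousOn.integrableOn_Icc),
    E.f_integral, ENNReal.ofReal_one]
  exact (ae_restrict_mem measurableSet_Icc).mono fun θ hθ => (E.f_pos θ hθ).le

theorem Env.F_singleton (θ : E.Ability) : E.F {θ} = 0 := by
  refine withDensity_absolutelyContinuous _ _ ?_
  rw [(MeasurableEmbedding.subtype_coe measurableSet_Icc).comap_apply, Set.image_singleton]
  exact Real.volume_singleton

instance Env.nullSingletonClass_F : NullSingletonClass E.F := ⟨E.F_singleton⟩

instance Env.nonempty_Ability : Nonempty E.Ability := ⟨⟨E.lo, le_rfl, E.lo_lt_hi.le⟩⟩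

theorem Env.norm_ability_le {x : ℝ} (hx : x ∈ Set.Icc E.lo E.hi) : ‖x‖ ≤ max |E.lo| |E.hi| :=
  abs_le_max_abs_abs hx.1 hx.2

theorem Env.integrable_of_mem_Icc {Ω : Type*} [MeasurableSpace Ω] {μ : Measure Ω}
    [IsFiniteMeasure μ] {g : Ω → ℝ} (hg : Measurable g) (h : ∀ x, g x ∈ Set.Icc E.lo E.hi) :
    Integrable g μ :=
  .of_bound hg.aestronglyMeasurable _ (.of_forall fun x => E.norm_ability_le (h x))

theorem Env.integral_mem_Icc {Ω : Type*} [MeasurableSpace Ω] {μ : Measure Ω}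
    [IsProbabilityMeasure μ] {g : Ω → ℝ} (hg : Measurable g) (h : ∀ x, g x ∈ Set.Icc E.lo E.hi) :
    ∫ x, g x ∂μ ∈ Set.Icc E.lo E.hi :=
  (convex_Icc _ _).integral_mem isClosed_Icc (.of_forall h) (E.integrable_of_mem_Icc hg h)

/-- Chebyshev's association inequality for the ability and a lower tail event. -/
theorem Env.setIntegral_Iic_le (b : Measure E.Ability) [IsProbabilityMeasure b] (a : E.Ability) :
    ∫ θ in Set.Iic a, (θ : ℝ) ∂b ≤ (∫ θ, (θ : ℝ) ∂b) * b.real (Set.Iic a) := by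
  have hint : Integrable (fun θ : E.Ability => (θ : ℝ)) b :=
    E.integrable_of_mem_Icc measurable_subtype_coe fun θ => θ.2
  have h1 : ∫ θ in Set.Iic a, (θ : ℝ) ∂b ≤ a * b.real (Set.Iic a) := by
    have := setIntegral_mono_on hint.integrableOn (integrableOn_const (C := (a : ℝ)))
      measurableSet_Iic (fun θ (hθ : θ ≤ a) => hθ)
    rwa [setIntegral_const, smul_eq_mul, mul_comm] at this
  have h2 : a * b.real (Set.Iic a)ᶜ ≤ ∫ θ in (Set.Iic a)ᶜ, (θ : ℝ) ∂b := by
    have := setIntegral_mono_on (integrableOn_const (C := (a : ℝ))) hint.integrableOn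
      measurableSet_Iic.compl (fun θ hθ => (not_le.mp hθ).le)
    rwa [setIntegral_const, smul_eq_mul, mul_comm] at this
  rw [← integral_add_compl (measurableSet_Iic (a := a)) hint]
  rw [probReal_compl_eq_one_sub measurableSet_Iic] at h2
  have h3 : b.real (Set.Iic a) ≤ 1 := measureReal_le_one
  have h4 : 0 ≤ b.real (Set.Iic a) := measureReal_nonneg
  -- With P the mass of the lower tail, both tail integrals, weighted by 1 - P and P, are compared
  -- with a P (1 - P).
  nlinarith [mul_le_mul_of_nonneg_right h1 (sub_nonneg.2 h3), mul_le_mul_of_nonneg_right h2 h4]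

end AbilityDistribution

/-! ### Necessity -/

section Necessity

variable {E : Env} {m : DirectMechanism E} {S : Type} [MeasurableSpace S]
  {π : Kernel E.Quality S} {belief : Kernel S E.Ability}

instance DirectMechanism.isMarkovKernel_scoreKernel [IsMarkovKernel π] :
    IsMarkovKernel (m.scoreKernel π) := by
  unfold DirectMechanism.scoreKernel; infer_instance

theorem measurable_marketWage : Measurable (marketWage belief) :=
  (measurable_subtype_coe.stronglyMeasurable.integral_kernel (κ := belief)).measurable

theorem marketWage_mem [IsMarkovKernel belief] (s : S) :
    marketWage belief s ∈ Set.Icc E.lo E.hi :=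
  E.integral_mem_Icc measurable_subtype_coe fun θ => θ.2

theorem DirectMechanism.BayesConsistent.integral_eq [IsMarkovKernel π] [IsMarkovKernel belief]
    (h : m.BayesConsistent π belief) {g : S × E.Ability → ℝ} (hg : Measurable g) (C : ℝ)
    (hC : ∀ x, ‖g x‖ ≤ C) :
    ∫ θ, ∫ s, g (s, θ) ∂(π (m.q θ)) ∂E.F =
      ∫ s, ∫ θ, g (s, θ) ∂(belief s) ∂(E.F.bind (m.scoreKernel π)) := by
  have key : ∫ x, g x ∂((E.F.compProd (m.scoreKernel π)).map Prod.swap) =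
      ∫ x, g x ∂((E.F.bind (m.scoreKernel π)).compProd belief) := by
    rw [show (E.F.compProd (m.scoreKernel π)).map Prod.swap = _ from h]
  have : IsProbabilityMeasure (E.F.bind (m.scoreKernel π)) := by infer_instance
  rw [integral_map measurable_swap.aemeasurable hg.aestronglyMeasurable,
    Measure.integral_compProd (f := fun x => g x.swap) (.of_bound (hg.comp measurable_swap).aestronglyMeasurable C
      (.of_forall fun x => hC _)),
    Measure.integral_compProd (.of_bound hg.aestronglyMeasurable C (.of_forall hC))] at key
  exact key

/-- Bayes' rule is applied to ω(s) 1_A(θ): the wage depends on s alone, so integrating out the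
ability leaves the posterior probability of A. -/
theorem DirectMechanism.BayesConsistent.setIntegral_wage [IsMarkovKernel π]
    [IsMarkovKernel belief] (h : m.BayesConsistent π belief)
    (hw : ∀ θ, m.w θ = ∫ s, marketWage belief s ∂(π (m.q θ)))
    {A : Set E.Ability} (hA : MeasurableSet A) :
    ∫ θ in A, m.w θ ∂E.F =
      ∫ s, marketWage belief s * (belief s).real A ∂(E.F.bind (m.scoreKernel π)) := by
  have := h.integral_eq
    (g := fun x => A.indicator (fun _ => marketWage belief x.1) x.2)
    (by
      have : (fun x : S × E.Ability => A.indicator (fun _ => marketWage belief x.1) x.2) =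
          (Prod.snd ⁻¹' A).indicator (fun x => marketWage belief x.1) := by
        ext x; rfl
      rw [this]
      exact (measurable_marketWage.comp measurable_fst).indicator (measurable_snd hA))
    (max |E.lo| |E.hi|)
    (fun x => (norm_indicator_le_norm_self _ _).trans (E.norm_ability_le (marketWage_mem _)))
  rw [← integral_indicator hA]
  convert this using 2
  · ext θ
    by_cases hθ : θ ∈ A <;> simp [hθ, hw]
  · ext s
    change _ = ∫ θ, A.indicator (fun _ => marketWage belief s) θ ∂belief s
    rw [integral_indicator hA, setIntegral_const, smul_eq_mul, mul_comm]

theorem DirectMechanism.BayesConsistent.setIntegral_ability [IsMarkovKernel π]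
    [IsMarkovKernel belief] (h : m.BayesConsistent π belief)
    {A : Set E.Ability} (hA : MeasurableSet A) :
    ∫ θ in A, (θ : ℝ) ∂E.F =
      ∫ s, ∫ θ in A, (θ : ℝ) ∂(belief s) ∂(E.F.bind (m.scoreKernel π)) := by
  have := h.integral_eq (g := fun x => A.indicator (fun θ => (θ : ℝ)) x.2)
    ((measurable_subtype_coe.indicator hA).comp measurable_snd)
    (max |E.lo| |E.hi|)
    (fun x => (norm_indicator_le_norm_self _ _).trans (E.norm_ability_le x.2.2))
  rw [← integral_indicator hA]
  simpa [integral_indicator hA] using this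

theorem DirectMechanism.Feasible.mps_and_bp (h : m.Feasible) : m.MPS ∧ m.BP := by
  obtain ⟨S, _, π, belief, _, _, hB, hw⟩ := h
  refine ⟨fun a => ?_, ?_⟩
  · rw [hB.setIntegral_wage hw measurableSet_Iic, hB.setIntegral_ability measurableSet_Iic]
    have hmeas : Measurable fun s => (belief s).real (Set.Iic a) :=
      (belief.measurable_coe measurableSet_Iic).ennreal_toReal
    refine integral_mono (.of_bound ?_ (max |E.lo| |E.hi|) (.of_forall fun s => ?_))
      (.of_bound (measurable_marketWage.mul hmeas).aestronglyMeasurable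
        (max |E.lo| |E.hi|) (.of_forall fun s => ?_))
      fun s => E.setIntegral_Iic_le (belief s) a
    · simp_rw [← integral_indicator (measurableSet_Iic (a := a))]
      exact ((measurable_subtype_coe.indicator
        measurableSet_Iic).stronglyMeasurable.integral_kernel).aestronglyMeasurable
    · refine (norm_setIntegral_le_of_norm_le_const (measure_lt_top _ _)
        fun θ _ => E.norm_ability_le θ.2).trans ?_
      exact mul_le_of_le_one_right (by positivity) measureReal_le_one
    · rw [norm_mul]
      refine (mul_le_mul (E.norm_ability_le (marketWage_mem s)) ?_ (norm_nonneg _)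
        (by positivity)).trans (mul_one _).le
      rw [Real.norm_of_nonneg measureReal_nonneg]
      exact measureReal_le_one
  · have h1 := hB.setIntegral_wage hw MeasurableSet.univ
    have h2 := hB.setIntegral_ability MeasurableSet.univ
    simp only [setIntegral_univ, probReal_univ, mul_one] at h1 h2
    exact h1.trans h2.symm

end Necessity

/-! ### Majorization against monotone functions -/

section Majorization

variable {E : Env} {m : DirectMechanism E}

/-- The mean-preserving-spread conditions bound the wage on every upper set of abilities. -/
theorem setIntegral_sub_nonneg_of_isUpperSet (hw : Measurable m.w) (hM : m.MPS) (hB : m.BP)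
    {U : Set E.Ability} (hU : IsUpperSet U) :
    0 ≤ ∫ θ in U, ((θ : ℝ) - m.w θ) ∂E.F := by
  have hid : Integrable (fun θ : E.Ability => (θ : ℝ)) E.F :=
    E.integrable_of_mem_Icc measurable_subtype_coe fun θ => θ.2
  have hwi : Integrable m.w E.F := E.integrable_of_mem_Icc hw m.w_mem
  have htot : ∫ θ, ((θ : ℝ) - m.w θ) ∂E.F = 0 := by
    rw [integral_sub hid hwi, sub_eq_zero]; exact hB.symm
  have hIic (a : E.Ability) : 0 ≤ ∫ θ in Set.Ioi a, ((θ : ℝ) - m.w θ) ∂E.F := by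
    have h1 := integral_add_compl (measurableSet_Iic (a := a)) (hid.sub hwi)
    have h2 := hM a
    simp only [Pi.sub_apply, Set.compl_Iic] at h1
    rw [htot, integral_sub hid.integrableOn hwi.integrableOn] at h1
    linarith
  rcases U.eq_empty_or_nonempty with rfl | ⟨u, hu⟩
  · simp
  have hlb : ∀ y ∈ Subtype.val '' U, E.lo ≤ y := by rintro _ ⟨y, -, rfl⟩; exact y.2.1
  -- An upper set is a ray from its infimum; whether the endpoint belongs to it is immaterial, as F
  -- has no atoms.
  let a : E.Ability := ⟨sInf (Subtype.val '' U), le_csInf ⟨_, _, hu, rfl⟩ hlb,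
    (csInf_le ⟨_, hlb⟩ ⟨_, hu, rfl⟩).trans u.2.2⟩
  have hsub : U ⊆ Set.Ici a := fun y hy => csInf_le (s := Subtype.val '' U) ⟨_, hlb⟩ ⟨y, hy, rfl⟩
  have hsup : Set.Ioi a ⊆ U := by
    intro y (hy : sInf (Subtype.val '' U) < (y : ℝ))
    obtain ⟨_, ⟨z, hz, rfl⟩, hzy⟩ := exists_lt_of_csInf_lt (Set.Nonempty.image _ ⟨u, hu⟩) hy
    exact hU (show z ≤ y from hzy.le) hz
  have hae : U =ᵐ[E.F] Set.Ioi a :=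
    (hsub.eventuallyLE.trans Ioi_ae_eq_Ici.symm.le).antisymm hsup.eventuallyLE
  rw [setIntegral_congr_set hae]
  exact hIic a

/-- Majorization tested against bounded monotone functions. -/
theorem integral_sub_mul_nonneg (hw : Measurable m.w) (hM : m.MPS) (hB : m.BP)
    {H : E.Ability → ℝ} (hH : Monotone H) (C : ℝ) (hC : ∀ θ, |H θ| ≤ C) :
    0 ≤ ∫ θ, ((θ : ℝ) - m.w θ) * H θ ∂E.F := by
  have hid : Integrable (fun θ : E.Ability => (θ : ℝ)) E.F :=
    E.integrable_of_mem_Icc measurable_subtype_coe fun θ => θ.2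
  have hwi : Integrable m.w E.F := E.integrable_of_mem_Icc hw m.w_mem
  have hd : Integrable (fun θ : E.Ability => (θ : ℝ) - m.w θ) E.F := hid.sub hwi
  have htot : ∫ θ, ((θ : ℝ) - m.w θ) ∂E.F = 0 := by
    rw [integral_sub hid hwi, sub_eq_zero]; exact hB.symm
  -- Layer cake: H + C is the integral over t in (-C, C] of the indicator of the upper set {t ≤ H}.
  -- The shift by C is harmless because θ - w integrates to zero.
  let k : E.Ability × ℝ → ℝ := fun x =>
    ({x | x.2 ≤ H x.1} : Set (E.Ability × ℝ)).indicator (fun x => (x.1 : ℝ) - m.w x.1) x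
  have hkm : Integrable k (E.F.prod (volume.restrict (Set.Ioc (-C) C))) :=
    (hd.comp_fst _).indicator
      (measurableSet_le measurable_snd (hH.measurable.comp measurable_fst))
  have hlayer (θ : E.Ability) :
      ∫ t in Set.Ioc (-C) C, k (θ, t) = ((θ : ℝ) - m.w θ) * (H θ + C) := by
    have : (fun t => k (θ, t)) =
        (Set.Iic (H θ)).indicator (fun _ => (θ : ℝ) - m.w θ) := by
      ext t; simp [k, Set.indicator]
    have hab := abs_le.1 (hC θ)
    rw [this, setIntegral_indicator measurableSet_Iic, Set.Ioc_inter_Iic, min_eq_right hab.2,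
      setIntegral_const, Real.volume_real_Ioc_of_le hab.1, smul_eq_mul]
    ring
  have hswap := integral_integral_swap (f := fun θ t => k (θ, t)) hkm
  simp_rw [hlayer] at hswap
  have hsplit : ∫ θ, ((θ : ℝ) - m.w θ) * (H θ + C) ∂E.F =
      ∫ θ, ((θ : ℝ) - m.w θ) * H θ ∂E.F := by
    have hdH : Integrable (fun θ : E.Ability => ((θ : ℝ) - m.w θ) * H θ) E.F :=
      hd.mul_bdd hH.measurable.aestronglyMeasurable (.of_forall hC)
    simp_rw [mul_add]
    rw [integral_add hdH (hd.mul_const C), integral_mul_const, htot, zero_mul, add_zero]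
  rw [← hsplit, hswap]
  refine integral_nonneg fun t => ?_
  have hU : IsUpperSet {θ | t ≤ H θ} := fun x y hxy (hx : t ≤ H x) => hx.trans (hH hxy)
  have hms : MeasurableSet {θ | t ≤ H θ} := measurableSet_le measurable_const hH.measurable
  have := setIntegral_sub_nonneg_of_isUpperSet hw hM hB hU
  rw [← integral_indicator hms] at this
  exact this

end Majorization

/-! ### Projection on the cone of monotone functions -/

section MonotoneCone

open scoped RealInnerProductSpace
open Filter Topology

theorem inner_Lp_eq_integral {α : Type*} [MeasurableSpace α] {μ : Measure α} {F H : Lp ℝ 2 μ}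
    {f h : α → ℝ} (hf : F =ᵐ[μ] f) (hh : H =ᵐ[μ] h) : ⟪F, H⟫ = ∫ x, f x * h x ∂μ := by
  rw [L2.inner_def]
  refine integral_congr_ae ?_
  filter_upwards [hf, hh] with x h1 h2
  rw [h1, h2, real_inner_comm]
  simp

/-- If `d` is uncorrelated with every `1`-Lipschitz function of `p`, then `E[d | p] = 0`. -/
theorem condExp_comap_eq_zero {α : Type*} [mα : MeasurableSpace α] {μ : Measure α}
    [IsProbabilityMeasure μ] {p d : α → ℝ} (hp : Measurable p) (hd : Integrable d μ)
    (h : ∀ k : ℝ → ℝ, LipschitzWith 1 k → ∫ x, d x * k (p x) ∂μ = 0) :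
    μ[d | MeasurableSpace.comap p inferInstance] =ᵐ[μ] 0 := by
  have h0 : ∫ x, d x ∂μ = 0 := by
    simpa using h (fun _ => 1) (LipschitzWith.const' 1)
  have hIoi (t : ℝ) : ∫ x in p ⁻¹' Set.Ioi t, d x ∂μ = 0 := by
    -- Capping the ramp at 1/(n+1) keeps the Lipschitz constant at 1; rescaled by n+1, it tends to
    -- the indicator of (t, ∞).
    let k : ℕ → ℝ → ℝ := fun n x => min ((n + 1 : ℝ)⁻¹) (max 0 (x - t))
    have hk (n : ℕ) : LipschitzWith 1 (k n) := by
      have : LipschitzWith 1 fun x : ℝ => x - t :=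
        LipschitzWith.of_dist_le_mul fun x y => by simp
      exact (this.const_max 0).const_min _
    have hk0 (n : ℕ) (x : ℝ) : 0 ≤ k n x := le_min (by positivity) (le_max_left _ _)
    have hk1 (n : ℕ) (x : ℝ) : (n + 1) * k n x ≤ 1 := by
      calc (n + 1) * k n x ≤ (n + 1) * (n + 1 : ℝ)⁻¹ := by gcongr; exact min_le_left _ _
        _ = 1 := mul_inv_cancel₀ (by positivity)
    have hlim : Tendsto (fun n : ℕ => ∫ x, d x * ((n + 1) * k n (p x)) ∂μ) atTop
        (𝓝 (∫ x, (p ⁻¹' Set.Ioi t).indicator d x ∂μ)) := by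
      refine tendsto_integral_of_dominated_convergence (fun x => ‖d x‖) (fun n => ?_) hd.norm
        (fun n => .of_forall fun x => ?_) (.of_forall fun x => ?_)
      · exact hd.aestronglyMeasurable.mul
          (((hk n).continuous.measurable.comp hp).const_mul _).aestronglyMeasurable
      · rw [norm_mul]
        refine mul_le_of_le_one_right (norm_nonneg _) ?_
        rw [Real.norm_of_nonneg (mul_nonneg (by positivity) (hk0 n _))]
        exact hk1 n _
      · by_cases hx : p x ∈ Set.Ioi t
        · rw [Set.indicator_of_mem (by exact hx)]
          refine tendsto_const_nhds.congr' ?_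
          have hpos : 0 < p x - t := sub_pos.2 hx
          filter_upwards [tendsto_one_div_add_atTop_nhds_zero_nat.eventually_lt_const hpos]
            with n hn
          have : k n (p x) = (n + 1 : ℝ)⁻¹ :=
            min_eq_left ((by simpa using hn.le : (n + 1 : ℝ)⁻¹ ≤ p x - t).trans (le_max_right _ _))
          rw [this, mul_inv_cancel₀ (by positivity), mul_one]
        · rw [Set.indicator_of_notMem (by exact hx)]
          have hle : p x - t ≤ 0 := sub_nonpos.2 (not_lt.1 hx)
          have (n : ℕ) : k n (p x) = 0 := by
            simp only [k, max_eq_left hle]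
            exact min_eq_right (by positivity)
          simp [this]
    rw [← integral_indicator (hp measurableSet_Ioi)]
    refine tendsto_nhds_unique hlim ?_
    have (n : ℕ) : ∫ x, d x * ((n + 1) * k n (p x)) ∂μ = 0 := by
      have := h (k n) (hk n)
      simp_rw [mul_left_comm (d _)]
      rw [integral_const_mul, this, mul_zero]
    simp [this]
  have hset : ∀ s : Set ℝ, MeasurableSet s → ∫ x in p ⁻¹' s, d x ∂μ = 0 := by
    refine MeasurableSpace.induction_on_inter (borel_eq_generateFrom_Ioi ℝ ▸
      BorelSpace.measurable_eq) isPiSystem_Ioi (by simp) ?_ ?_ ?_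
    · rintro _ ⟨t, rfl⟩
      exact hIoi t
    · intro t ht hc
      have := integral_add_compl (hp ht) hd
      rw [hc, h0, zero_add] at this
      exact this
    · intro f hdisj hf hc
      rw [Set.preimage_iUnion, integral_iUnion (fun i => hp (hf i))
        (fun i j hij => (hdisj hij).preimage p) hd.integrableOn]
      simp [hc]
  refine (ae_eq_condExp_of_forall_setIntegral_eq hp.comap_le hd
    (fun _ _ _ => integrableOn_zero) ?_ aestronglyMeasurable_zero).symm
  rintro _ ⟨s, hs, rfl⟩ -
  simp [hset s hs]

variable {α : Type*} [LinearOrder α] [mα : MeasurableSpace α]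

/-- Square-integrable functions with a bounded monotone version. -/
def boundedMonotone (μ : Measure α) : Set (Lp ℝ 2 μ) :=
  {f | ∃ g : α → ℝ, Monotone g ∧ (∃ C, ∀ x, |g x| ≤ C) ∧ f =ᵐ[μ] g}

variable {μ : Measure α}

theorem convex_boundedMonotone : Convex ℝ (boundedMonotone μ) := by
  rintro f ⟨f', hf, ⟨C, hC⟩, hff⟩ g ⟨g', hg, ⟨D, hD⟩, hgg⟩ a b ha hb -
  refine ⟨fun x => a * f' x + b * g' x,
    (hf.const_mul ha).add (hg.const_mul hb), ⟨a * C + b * D, fun x => ?_⟩, ?_⟩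
  · refine (abs_add_le _ _).trans ?_
    rw [abs_mul, abs_mul, abs_of_nonneg ha, abs_of_nonneg hb]
    gcongr
    exacts [hC x, hD x]
  · filter_upwards [Lp.coeFn_add (a • f) (b • g), Lp.coeFn_smul a f, Lp.coeFn_smul b g, hff, hgg]
      with x h1 h2 h3 h4 h5
    rw [h1, Pi.add_apply, h2, h3, Pi.smul_apply, Pi.smul_apply, h4, h5, smul_eq_mul, smul_eq_mul]

theorem add_mem_closure_boundedMonotone {f g : Lp ℝ 2 μ}
    (hf : f ∈ closure (boundedMonotone μ)) (hg : g ∈ closure (boundedMonotone μ)) :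
    f + g ∈ closure (boundedMonotone μ) := by
  refine map_mem_closure₂ continuous_add hf hg ?_
  rintro f ⟨f', hf, ⟨C, hC⟩, hff⟩ g ⟨g', hg, ⟨D, hD⟩, hgg⟩
  refine ⟨f' + g', hf.add hg, ⟨C + D, fun x => (abs_add_le _ _).trans (add_le_add (hC x) (hD x))⟩, ?_⟩
  filter_upwards [Lp.coeFn_add f g, hff, hgg] with x h1 h2 h3
  rw [h1, Pi.add_apply, h2, h3, Pi.add_apply]

/-- Lipschitz composition is continuous on L², hence passes to the closure. It supplies the
competitors p + k(p) to the projection p. -/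
theorem compLp_mem_closure_boundedMonotone {f : Lp ℝ 2 μ} {k : ℝ → ℝ} {c : NNReal}
    (hk : LipschitzWith c k) (hk0 : k 0 = 0) (hmono : Monotone k)
    (hf : f ∈ closure (boundedMonotone μ)) :
    hk.compLp hk0 f ∈ closure (boundedMonotone μ) := by
  refine map_mem_closure (hk.continuous_compLp hk0) hf ?_
  rintro f ⟨f', hf, ⟨C, hC⟩, hff⟩
  refine ⟨k ∘ f', hmono.comp hf, ⟨c * C, fun x => ?_⟩, ?_⟩
  · have := hk.dist_le_mul (f' x) 0
    rw [hk0, dist_zero_right, dist_zero_right] at this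
    exact this.trans (by gcongr; exact hC x)
  · filter_upwards [hk.coeFn_compLp hk0 f, hff] with x h1 h2
    simp [h1, h2]

/-- Among the conditional expectations of `X`, some one is at least as good against `ψ` as any given
bounded monotone function majorized by `X`. The `σ`-algebra is generated by the projection
of `ψ` on the closed cone of monotone functions. -/
theorem exists_condExp_integral_ge [TopologicalSpace α] [OrderClosedTopology α] [BorelSpace α]
    [IsProbabilityMeasure μ] {X w ψ : α → ℝ} {C : ℝ}
    (hX : Measurable X) (hXC : ∀ x, |X x| ≤ C) (hw : Monotone w) (hwC : ∀ x, |w x| ≤ C)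
    (hmaj : ∀ h : α → ℝ, Monotone h → (∃ D, ∀ x, |h x| ≤ D) → 0 ≤ ∫ x, (X x - w x) * h x ∂μ)
    (hψ : Measurable ψ) {D : ℝ} (hψD : ∀ x, |ψ x| ≤ D) :
    ∃ m ≤ mα, ∫ x, w x * ψ x ∂μ ≤ ∫ x, (μ[X | m]) x * ψ x ∂μ := by
  have hwm : Measurable w := hw.measurable
  have hI {f g : α → ℝ} (hf : MemLp f 2 μ) (hg : MemLp g 2 μ) :
      Integrable (fun x => f x * g x) μ := hf.integrable_mul hg
  have hXL : MemLp X 2 μ := .of_bound hX.aestronglyMeasurable C (.of_forall hXC)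
  have hwL : MemLp w 2 μ := .of_bound hwm.aestronglyMeasurable C (.of_forall hwC)
  have hψL : MemLp ψ 2 μ := .of_bound hψ.aestronglyMeasurable D (.of_forall hψD)
  have hconst (c : ℝ) : (memLp_const c : MemLp (fun _ : α => c) 2 μ).toLp ∈
      closure (boundedMonotone μ) :=
    subset_closure ⟨fun _ => c, monotone_const, ⟨|c|, fun _ => le_rfl⟩, MemLp.coeFn_toLp _⟩
  have hzero : (0 : Lp ℝ 2 μ) ∈ closure (boundedMonotone μ) :=
    subset_closure ⟨fun _ => 0, monotone_const, ⟨0, by simp⟩, Lp.coeFn_zero _ _ _⟩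
  have hwK : hwL.toLp ∈ closure (boundedMonotone μ) :=
    subset_closure ⟨w, hw, ⟨C, hwC⟩, hwL.coeFn_toLp⟩
  obtain ⟨P, hPK, hP⟩ := exists_norm_eq_iInf_of_complete_convex ⟨0, hzero⟩
    isClosed_closure.isComplete convex_boundedMonotone.closure hψL.toLp
  rw [norm_eq_iInf_iff_real_inner_le_zero convex_boundedMonotone.closure hPK] at hP
  -- The variational inequality of the projection is tested at P + f, and below at 0.
  have hcone (f : Lp ℝ 2 μ) (hf : f ∈ closure (boundedMonotone μ)) :
      ⟪hψL.toLp - P, f⟫ ≤ 0 := by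
    simpa using hP _ (add_mem_closure_boundedMonotone hf hPK)
  have hperp : ⟪hψL.toLp - P, P⟫ = 0 := by
    refine le_antisymm (hcone P hPK) ?_
    have := hP 0 hzero
    rwa [zero_sub, inner_neg_right, neg_nonpos] at this
  let p : α → ℝ := P
  have hp : Measurable p := (Lp.stronglyMeasurable P).measurable
  have hpL : MemLp p 2 μ := Lp.memLp P
  have hdL : MemLp (ψ - p) 2 μ := hψL.sub hpL
  have hd : ⇑(hψL.toLp - P) =ᵐ[μ] ψ - p := by
    filter_upwards [Lp.coeFn_sub hψL.toLp P, hψL.coeFn_toLp] with x h1 h2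
    rw [h1, Pi.sub_apply, h2, Pi.sub_apply]
  -- x + k(x) is monotone because k, being 1-Lipschitz, cannot fall faster than x rises.
  have hmono (k : ℝ → ℝ) (hk : LipschitzWith 1 k) (hk0 : k 0 = 0) :
      ∫ x, (ψ - p) x * (p x + k (p x)) ∂μ ≤ 0 := by
    have h1 : LipschitzWith 2 fun x => x + k x := by
      have := LipschitzWith.id.add hk
      rwa [one_add_one_eq_two] at this
    have h2 : Monotone fun x => x + k x := by
      intro x y hxy
      have := hk.dist_le_mul x y
      rw [Real.dist_eq, Real.dist_eq, NNReal.coe_one, one_mul, abs_sub_comm x,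
        abs_of_nonneg (sub_nonneg.2 hxy)] at this
      have := (abs_le.1 this).2
      simp only
      linarith
    have h3 : (0 : ℝ) + k 0 = 0 := by simp [hk0]
    exact (inner_Lp_eq_integral hd (h1.coeFn_compLp h3 P)).symm.trans_le <|
      hcone _ (compLp_mem_closure_boundedMonotone h1 h3 h2 hPK)
  have hdp : ∫ x, (ψ - p) x * p x ∂μ = 0 := by
    rw [← inner_Lp_eq_integral hd (.refl _ _)]; exact hperp
  have hd0 (c : ℝ) : ∫ x, (ψ - p) x * c ∂μ ≤ 0 := by
    rw [← inner_Lp_eq_integral hd (MemLp.coeFn_toLp (memLp_const c))]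
    exact hcone _ (hconst c)
  have hdint : Integrable (ψ - p) μ := hdL.integrable one_le_two
  have hLip (k : ℝ → ℝ) (hk : LipschitzWith 1 k) (hk0 : k 0 = 0) :
      ∫ x, (ψ - p) x * k (p x) ∂μ ≤ 0 := by
    have hkL : MemLp (fun x => k (p x)) 2 μ :=
      (memLp_congr_ae (hk.coeFn_compLp hk0 P)).1 (Lp.memLp _)
    have := hmono k hk hk0
    simp_rw [mul_add] at this
    rwa [integral_add (hI hdL hpL) (hI hdL hkL), hdp, zero_add] at this
  -- The normalization k(0) = 0 is removed by splitting off a constant, which lies in the cone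
  -- whatever its sign.
  have hLip' (k : ℝ → ℝ) (hk : LipschitzWith 1 k) : ∫ x, (ψ - p) x * k (p x) ∂μ ≤ 0 := by
    have h1 : LipschitzWith 1 fun x => k x - k 0 :=
      LipschitzWith.of_dist_le_mul fun x y => by simpa using hk.dist_le_mul x y
    have h2 : k 0 - k 0 = 0 := sub_self _
    have hkL : MemLp (fun x => k (p x) - k 0) 2 μ :=
      (memLp_congr_ae (h1.coeFn_compLp h2 P)).1 (Lp.memLp _)
    have e : ∫ x, (ψ - p) x * k (p x) ∂μ =
        ∫ x, (ψ - p) x * (k (p x) - k 0) ∂μ + ∫ x, (ψ - p) x * k 0 ∂μ := by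
      rw [← integral_add (hI hdL hkL) (hdint.mul_const _)]
      simp_rw [← mul_add, sub_add_cancel]
    rw [e]
    exact add_nonpos (hLip _ h1 h2) (hd0 _)
  refine ⟨MeasurableSpace.comap p inferInstance, hp.comap_le, ?_⟩
  have hcond : μ[ψ - p | .comap p inferInstance] =ᵐ[μ] 0 := by
    refine condExp_comap_eq_zero hp hdint fun k hk => le_antisymm (hLip' k hk) ?_
    have := hLip' (fun x => -k x) hk.neg
    simpa [integral_neg] using this
  have hXi : Integrable X μ := hXL.integrable one_le_two
  have hvC : ∀ᵐ x ∂μ, |(μ[X | .comap p inferInstance]) x| ≤ C :=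
    ae_bdd_abs_condExp_of_ae_bdd_abs (.of_forall hXC)
  have hvL : MemLp (μ[X | .comap p inferInstance]) 2 μ :=
    .of_bound (stronglyMeasurable_condExp.mono hp.comap_le).aestronglyMeasurable C hvC
  have hvd : ∫ x, (μ[X | .comap p inferInstance]) x * (ψ - p) x ∂μ = 0 := by
    have h1 := condExp_mul_of_stronglyMeasurable_left (μ := μ) (m := .comap p inferInstance)
      (f := μ[X | .comap p inferInstance]) (g := ψ - p) stronglyMeasurable_condExp (hI hvL hdL) hdint
    have h2 := integral_condExp (μ := μ) (f := μ[X | .comap p inferInstance] * (ψ - p)) hp.comap_le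
    rw [← show ∫ x, (μ[X | .comap p inferInstance] * (ψ - p)) x ∂μ = ∫ x, (μ[X | .comap p inferInstance]) x * (ψ - p) x ∂μ from rfl, ← h2]
    rw [integral_congr_ae h1]
    refine integral_eq_zero_of_ae ?_
    filter_upwards [hcond] with x hx
    simp [hx]
  have hvp : ∫ x, (μ[X | .comap p inferInstance]) x * p x ∂μ = ∫ x, X x * p x ∂μ := by
    have h1 := condExp_mul_of_stronglyMeasurable_right (μ := μ) (m := .comap p inferInstance) (f := X) (g := p)
      (comap_measurable p).stronglyMeasurable (hI hXL hpL) hXi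
    have h2 := integral_condExp (μ := μ) (f := X * p) hp.comap_le
    rw [integral_congr_ae h1] at h2
    exact h2
  have hXw : 0 ≤ ∫ x, (X x - w x) * p x ∂μ := by
    have hXwL := hXL.sub hwL
    -- The projection is only an L² limit of bounded monotone functions; the closed half-space
    -- carries the majorization to it.
    have : closure (boundedMonotone μ) ⊆ {f | 0 ≤ ⟪hXwL.toLp, f⟫} := by
      refine closure_minimal ?_ (isClosed_le continuous_const (by fun_prop))
      rintro f ⟨g, hg, hgC, hfg⟩
      rw [Set.mem_ofPred_eq, inner_Lp_eq_integral hXwL.coeFn_toLp hfg]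
      exact hmaj g hg hgC
    have := this hPK
    rwa [Set.mem_ofPred_eq, inner_Lp_eq_integral hXwL.coeFn_toLp (.refl _ _)] at this
  have hdw : ∫ x, (ψ - p) x * w x ∂μ ≤ 0 := by
    rw [← inner_Lp_eq_integral hd hwL.coeFn_toLp]
    exact hcone _ hwK
  have e1 : ∫ x, (μ[X | .comap p inferInstance]) x * ψ x ∂μ = ∫ x, X x * p x ∂μ := by
    rw [← hvp, ← add_zero (∫ x, (μ[X | .comap p inferInstance]) x * p x ∂μ), ← hvd,
      ← integral_add (hI hvL hpL) (hI hvL hdL)]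
    refine integral_congr_ae (.of_forall fun x => ?_)
    simp only [Pi.sub_apply]; ring
  have e2 : ∫ x, (X x - w x) * p x ∂μ = ∫ x, X x * p x ∂μ - ∫ x, w x * p x ∂μ := by
    simp_rw [sub_mul]
    exact integral_sub (hI hXL hpL) (hI hwL hpL)
  have e3 : ∫ x, (ψ - p) x * w x ∂μ = ∫ x, w x * ψ x ∂μ - ∫ x, w x * p x ∂μ := by
    rw [← integral_sub (hI hwL hψL) (hI hwL hpL)]
    refine integral_congr_ae (.of_forall fun x => ?_)
    simp only [Pi.sub_apply]; ring
  linarith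

end MonotoneCone

/-! ### A moment problem by Riesz extension -/

section MomentProblem

/-- A generalized moment problem on a compact space: prescribed integrals of a linear family of
continuous functions are realized by a measure as soon as they respect positivity. -/
theorem exists_measure_integral_eq {K V : Type*} [TopologicalSpace K] [CompactSpace K] [T2Space K]
    [MeasurableSpace K] [BorelSpace K] [AddCommGroup V] [Module ℝ V] (T : V →ₗ[ℝ] C(K, ℝ))
    (l : V →ₗ[ℝ] ℝ) (h : ∀ v, 0 ≤ T v → 0 ≤ l v) (u : V) (hu : T u = 1) :
    ∃ γ : Measure K, IsFiniteMeasure γ ∧ ∀ v, ∫ x, T v x ∂γ = l v := by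
  have hker : LinearMap.ker T ≤ LinearMap.ker l := by
    intro v hv
    rw [LinearMap.mem_ker] at hv ⊢
    refine le_antisymm ?_ (h v hv.ge)
    have := h (-v) (by simp [hv])
    simpa using this
  -- Positivity at v and -v makes l vanish on the kernel of T, so l descends to the range.
  let f : C(K, ℝ) →ₗ.[ℝ] ℝ :=
    ⟨LinearMap.range T, (LinearMap.ker T).liftQ l hker ∘ₗ T.quotKerEquivRange.symm.toLinearMap⟩
  have hf (v : V) : f ⟨T v, v, rfl⟩ = l v := by
    change (LinearMap.ker T).liftQ l hker (T.quotKerEquivRange.symm ⟨T v, v, rfl⟩) = l v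
    have : (⟨T v, v, rfl⟩ : LinearMap.range T) =
        T.quotKerEquivRange (Submodule.Quotient.mk v) := rfl
    rw [this, LinearEquiv.symm_apply_apply]
    exact (LinearMap.ker T).liftQ_apply l v
  obtain ⟨g, hg, hpos⟩ := riesz_extension (PointedCone.positive ℝ C(K, ℝ)) f
    (by
      rintro ⟨_, v, rfl⟩ hv
      rw [hf]
      exact h v hv)
    (by
      intro y
      refine ⟨⟨T (‖y‖ • u), _, rfl⟩, fun x => ?_⟩
      have := neg_le_of_abs_le (y.norm_coe_le_norm x)
      simp [hu]
      linarith)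
  let Λ : CompactlySupportedContinuousMap K ℝ →ₚ[ℝ] ℝ := PositiveLinearMap.mk₀
    { toFun := fun f => g f.toContinuousMap
      map_add' := fun a b => g.map_add _ _
      map_smul' := fun a b => g.map_smul _ _ }
    fun a ha => hpos _ ha
  refine ⟨RealRMK.rieszMeasure Λ, inferInstance, fun v => ?_⟩
  rw [← hf, ← hg]
  exact RealRMK.integral_rieszMeasure Λ (CompactlySupportedContinuousMap.continuousMapEquiv (T v))

end MomentProblem

/-! ### Construction of the rating scheme -/

section Construction

variable (E : Env)

/-- Subtracting `E.lo` turns both functions into densities of finite measures, which bounded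
continuous functions separate. -/
theorem Env.ae_eq_of_forall_integral_mul_eq {Ω : Type*} [TopologicalSpace Ω] [MeasurableSpace Ω]
    [HasOuterApproxClosed Ω] [BorelSpace Ω] {μ : Measure Ω} [IsFiniteMeasure μ] {f g : Ω → ℝ}
    (hf : Measurable f) (hg : Measurable g) (hf' : ∀ x, f x ∈ Set.Icc E.lo E.hi)
    (hg' : ∀ x, g x ∈ Set.Icc E.lo E.hi)
    (h : ∀ ψ : BoundedContinuousFunction Ω ℝ, ∫ x, f x * ψ x ∂μ = ∫ x, g x * ψ x ∂μ) :
    f =ᵐ[μ] g := by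
  have hfin {f : Ω → ℝ} (hf' : ∀ x, f x ∈ Set.Icc E.lo E.hi) :
      ∫⁻ x, ENNReal.ofReal (f x - E.lo) ∂μ ≠ ⊤ := by
    refine ((lintegral_mono (g := fun _ => ENNReal.ofReal (E.hi - E.lo)) fun x =>
      ENNReal.ofReal_le_ofReal (sub_le_sub_right (hf' x).2 _)).trans_lt ?_).ne
    rw [lintegral_const]
    exact ENNReal.mul_lt_top ENNReal.ofReal_lt_top (measure_lt_top _ _)
  have hint {f : Ω → ℝ} (hf : Measurable f) (hf' : ∀ x, f x ∈ Set.Icc E.lo E.hi)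
      (ψ : BoundedContinuousFunction Ω ℝ) :
      ∫ x, ψ x ∂(μ.withDensity fun x => ENNReal.ofReal (f x - E.lo)) =
        ∫ x, f x * ψ x ∂μ - E.lo * ∫ x, ψ x ∂μ := by
    rw [integral_withDensity_eq_integral_toReal_smul
      (hf.sub_const _).ennreal_ofReal (.of_forall fun _ => ENNReal.ofReal_lt_top),
      ← integral_const_mul, ← integral_sub]
    · refine integral_congr_ae (.of_forall fun x => ?_)
      simp only [ENNReal.toReal_ofReal (sub_nonneg.2 (hf' x).1), smul_eq_mul]
      ring
    · exact (E.integrable_of_mem_Icc hf hf').mul_bdd (c := ‖ψ‖)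
        ψ.continuous.measurable.aestronglyMeasurable (.of_forall ψ.norm_coe_le_norm)
    · exact (ψ.integrable μ).const_mul _
  have := isFiniteMeasure_withDensity (hfin hf')
  have := isFiniteMeasure_withDensity (hfin hg')
  have key : μ.withDensity (fun x => ENNReal.ofReal (f x - E.lo)) =
      μ.withDensity fun x => ENNReal.ofReal (g x - E.lo) :=
    ext_of_forall_integral_eq_of_IsFiniteMeasure fun ψ => by
      rw [hint hf hf', hint hg hg', h]
  rw [withDensity_eq_iff (hf.sub_const _).ennreal_ofReal.aemeasurable
    (hg.sub_const _).ennreal_ofReal.aemeasurable (hfin hf')] at key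
  filter_upwards [key] with x hx
  rw [ENNReal.ofReal_eq_ofReal_iff (sub_nonneg.2 (hf' x).1) (sub_nonneg.2 (hg' x).1)] at hx
  linarith

/-- Some deterministic score, a conditional expectation `v` of `X`, is uncorrelated with the
residual `X - v` and does no better against `ψ` than the majorized monotone wage `W`. -/
theorem Env.exists_score {G : Measure E.Quality} [IsProbabilityMeasure G]
    {X W : E.Quality → E.Ability} (hX : Measurable X) (hW : Monotone W)
    (hmaj : ∀ h : E.Quality → ℝ, Monotone h → (∃ D, ∀ x, |h x| ≤ D) →
      0 ≤ ∫ x, ((X x : ℝ) - W x) * h x ∂G) (ψ : C(E.Quality, ℝ)) :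
    ∃ v : E.Quality → E.Ability, Measurable v ∧
      (∀ χ : C(E.Ability, ℝ), ∫ x, ((X x : ℝ) - v x) * χ (v x) ∂G = 0) ∧
      ∫ x, (v x : ℝ) * ψ x ∂G ≤ ∫ x, (W x : ℝ) * ψ x ∂G := by
  have hXm : Measurable fun x => (X x : ℝ) := measurable_subtype_coe.comp hX
  have hint {v : E.Quality → E.Ability} (hv : Measurable v) :
      Integrable (fun x => (v x : ℝ)) G :=
    E.integrable_of_mem_Icc (measurable_subtype_coe.comp hv) fun x => (v x).2
  have hXi := hint hX
  obtain ⟨m, hm, hle⟩ := exists_condExp_integral_ge (μ := G) (X := fun x => (X x : ℝ))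
    (w := fun x => (W x : ℝ)) (ψ := fun x => -ψ x) hXm (fun x => E.norm_ability_le (X x).2)
    (fun x y hxy => hW hxy) (fun x => E.norm_ability_le (W x).2) hmaj
    ψ.continuous.measurable.neg (D := ‖ψ‖) (fun x => by rw [abs_neg]; exact ψ.norm_coe_le_norm x)
  let v₀ : E.Quality → ℝ := G[fun x => (X x : ℝ) | m]
  have hv₀ : Measurable[m] v₀ := stronglyMeasurable_condExp.measurable
  -- A conditional expectation lies in [lo, hi] only almost everywhere; clamping gives a version in
  -- Θ that is still m-measurable.
  let v : E.Quality → E.Ability := fun x => Set.projIcc E.lo E.hi E.lo_lt_hi.le (v₀ x)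
  have hvm : Measurable[m] v := continuous_projIcc.measurable.comp hv₀
  have hv : Measurable[Subtype.instMeasurableSpace] v := Measurable.mono hvm hm le_rfl
  have hae : ∀ᵐ x ∂G, (v x : ℝ) = v₀ x := by
    have h1 := condExp_mono (m := m) (integrable_const (μ := G) E.lo) hXi
      (.of_forall fun x => (X x).2.1)
    have h2 := condExp_mono (m := m) hXi (integrable_const (μ := G) E.hi)
      (.of_forall fun x => (X x).2.2)
    rw [condExp_const hm] at h1 h2
    filter_upwards [h1, h2] with x hx1 hx2
    simp only [v]
    rw [Set.projIcc_of_mem _ (show v₀ x ∈ Set.Icc E.lo E.hi from ⟨hx1, hx2⟩)]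
  refine ⟨v, hv, fun χ => ?_, ?_⟩
  · have hχm : Measurable[m] fun x => χ (v x) := χ.continuous.measurable.comp hvm
    have hχ : Integrable (fun x => (X x : ℝ) * χ (v x)) G :=
      hXi.mul_bdd (c := ‖χ‖) (hχm.mono hm le_rfl).aestronglyMeasurable
        (.of_forall fun x => χ.norm_coe_le_norm _)
    have hvχ : Integrable (fun x => (v x : ℝ) * χ (v x)) G :=
      (hint hv).mul_bdd
        (c := ‖χ‖) (hχm.mono hm le_rfl).aestronglyMeasurable
        (.of_forall fun x => χ.norm_coe_le_norm _)
    have h1 := condExp_mul_of_stronglyMeasurable_right (μ := G) (m := m)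
      (f := fun x => (X x : ℝ)) (g := fun x => χ (v x)) hχm.stronglyMeasurable hχ hXi
    have h2 := integral_condExp (μ := G) (f := (fun x => (X x : ℝ)) * fun x => χ (v x)) hm
    rw [integral_congr_ae h1] at h2
    simp_rw [sub_mul]
    rw [integral_sub hχ hvχ, sub_eq_zero]
    refine h2.symm.trans (integral_congr_ae ?_)
    filter_upwards [hae] with x hx
    rw [hx]; rfl
  · simp_rw [mul_neg, integral_neg, neg_le_neg_iff] at hle
    refine (integral_congr_ae ?_).trans_le hle
    filter_upwards [hae] with x hx
    rw [hx]

/-- The test functions `(q, x, s) ↦ φ (q, x) + (x - s) χ(s) + s ψ(q)`. -/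
noncomputable def Env.testFunction :
    (C(E.Quality × E.Ability, ℝ) × C(E.Ability, ℝ) × C(E.Quality, ℝ)) →ₗ[ℝ]
      C((E.Quality × E.Ability) × E.Ability, ℝ) where
  toFun p := ⟨fun z => p.1 z.1 + ((z.1.2 : ℝ) - z.2) * p.2.1 z.2 + z.2 * p.2.2 z.1.1, by fun_prop⟩
  map_add' p p' := by ext z; simp; ring
  map_smul' a p := by ext z; simp; ring

/-- In the moment problem φ fixes the law of (q, X(q)), χ encodes E[X | s] = s, and ψ encodes E[s |
q] = W. The mean ability is a separate coordinate because X is merely measurable while test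
functions must be continuous. Disintegrating the solution over (q, X(q)) gives the kernel. -/
theorem Env.exists_ratingScheme {G : Measure E.Quality} [IsProbabilityMeasure G]
    {X W : E.Quality → E.Ability} (hX : Measurable X) (hW : Monotone W)
    (hmaj : ∀ h : E.Quality → ℝ, Monotone h → (∃ D, ∀ x, |h x| ≤ D) →
      0 ≤ ∫ x, ((X x : ℝ) - W x) * h x ∂G) :
    ∃ π : Kernel E.Quality E.Ability, IsMarkovKernel π ∧
      (∀ᵐ x ∂G, ∫ s, (s : ℝ) ∂(π x) = W x) ∧
      ∀ χ : C(E.Ability, ℝ), ∫ x, ∫ s, ((X x : ℝ) - s) * χ s ∂(π x) ∂G = 0 := by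
  have hWm : Measurable W := hW.measurable
  let e : E.Quality → E.Quality × E.Ability := fun x => (x, X x)
  have he : Measurable e := measurable_id.prodMk hX
  have hWi : Integrable (fun x => (W x : ℝ)) G :=
    E.integrable_of_mem_Icc (measurable_subtype_coe.comp hWm) fun x => (W x).2
  have hφi (φ : C(E.Quality × E.Ability, ℝ)) : Integrable (fun x => φ (e x)) G :=
    .of_bound (φ.continuous.measurable.comp he).aestronglyMeasurable ‖φ‖
      (.of_forall fun x => φ.norm_coe_le_norm _)
  have hψi {Y : E.Quality → ℝ} (hY : Integrable Y G) (ψ : C(E.Quality, ℝ)) :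
      Integrable (fun x => Y x * ψ x) G :=
    hY.mul_bdd (c := ‖ψ‖) ψ.continuous.measurable.aestronglyMeasurable
      (.of_forall fun x => ψ.norm_coe_le_norm _)
  let l : (C(E.Quality × E.Ability, ℝ) × C(E.Ability, ℝ) × C(E.Quality, ℝ)) →ₗ[ℝ] ℝ :=
    { toFun := fun p => ∫ x, p.1 (e x) ∂G + ∫ x, (W x : ℝ) * p.2.2 x ∂G
      map_add' := fun p p' => by
        simp only [Prod.fst_add, Prod.snd_add, ContinuousMap.add_apply, mul_add]
        rw [integral_add (hφi _) (hφi _), integral_add (hψi hWi _) (hψi hWi _)]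
        ring
      map_smul' := fun a p => by
        simp only [Prod.smul_fst, Prod.smul_snd, ContinuousMap.smul_apply, smul_eq_mul,
          mul_left_comm _ a, integral_const_mul, RingHom.id_apply]
        ring }
  obtain ⟨γ, _, hγ⟩ := exists_measure_integral_eq E.testFunction l
    (by
      rintro ⟨φ, χ, ψ⟩ h
      obtain ⟨v, hv, hvχ, hvψ⟩ := E.exists_score hX hW hmaj ψ
      have hvi : Integrable (fun x => (v x : ℝ)) G :=
        E.integrable_of_mem_Icc (measurable_subtype_coe.comp hv) fun x => (v x).2
      have hXi : Integrable (fun x => (X x : ℝ)) G :=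
        E.integrable_of_mem_Icc (measurable_subtype_coe.comp hX) fun x => (X x).2
      have hχi : Integrable (fun x => ((X x : ℝ) - v x) * χ (v x)) G :=
        (hXi.sub hvi).mul_bdd (c := ‖χ‖) (χ.continuous.measurable.comp hv).aestronglyMeasurable
          (.of_forall fun x => χ.norm_coe_le_norm _)
      -- The nonnegative test function is evaluated along (q, X(q), v(q)): its χ-term integrates to
      -- zero and its ψ-term is at most that of W.
      have hpos : 0 ≤ ∫ x, φ (e x) + ((X x : ℝ) - v x) * χ (v x) + v x * ψ x ∂G :=
        integral_nonneg fun x => h (e x, v x)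
      rw [integral_add (Integrable.fun_add (hφi φ) hχi) (hψi hvi ψ), integral_add (hφi φ) hχi, hvχ] at hpos
      change 0 ≤ ∫ x, φ (e x) ∂G + ∫ x, (W x : ℝ) * ψ x ∂G
      linarith)
    (1, 0, 0) (by ext z; simp [Env.testFunction])
  have hfst : γ.fst = G.map e := by
    refine ext_of_forall_integral_eq_of_IsFiniteMeasure fun φ => ?_
    rw [Measure.fst, integral_map measurable_fst.aemeasurable
      φ.continuous.measurable.aestronglyMeasurable, integral_map he.aemeasurable
      φ.continuous.measurable.aestronglyMeasurable]
    simpa [Env.testFunction, l] using hγ (φ.toContinuousMap, 0, 0)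
  have hdis (g : C((E.Quality × E.Ability) × E.Ability, ℝ)) :
      ∫ z, g z ∂γ = ∫ x, ∫ s, g (e x, s) ∂(γ.condKernel (e x)) ∂G := by
    have hgi : Integrable g (γ.fst ⊗ₘ γ.condKernel) :=
      .of_bound g.continuous.measurable.aestronglyMeasurable ‖g‖
        (.of_forall g.norm_coe_le_norm)
    conv_lhs => rw [← γ.disintegrate γ.condKernel]
    rw [Measure.integral_compProd hgi, hfst, integral_map he.aemeasurable]
    exact (g.continuous.measurable.stronglyMeasurable.integral_kernel_prod_right'
      (κ := γ.condKernel)).aestronglyMeasurable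
  refine ⟨γ.condKernel.comap e he, inferInstance, ?_, fun χ => ?_⟩
  · refine E.ae_eq_of_forall_integral_mul_eq
      (measurable_subtype_coe.stronglyMeasurable.integral_kernel
        (κ := γ.condKernel.comap e he)).measurable
      (measurable_subtype_coe.comp hWm)
      (fun x => E.integral_mem_Icc measurable_subtype_coe fun s => s.2) (fun x => (W x).2)
      fun ψ => ?_
    have h1 := hγ (0, 0, ψ.toContinuousMap)
    rw [hdis] at h1
    simpa [Env.testFunction, l, integral_mul_const] using h1
  · have h1 := hγ (0, χ, 0)
    rw [hdis] at h1
    simpa [Env.testFunction, l] using h1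

end Construction

/-! ### Sufficiency -/

section Sufficiency

variable {E : Env}

/-- Feasibility concerns every type, so on the exceptional null set the score is set to W(q) itself,
which changes no integral. -/
theorem Env.exists_ratingScheme_forall {G : Measure E.Quality} [IsProbabilityMeasure G]
    {X W : E.Quality → E.Ability} (hX : Measurable X) (hW : Monotone W)
    (hmaj : ∀ h : E.Quality → ℝ, Monotone h → (∃ D, ∀ x, |h x| ≤ D) →
      0 ≤ ∫ x, ((X x : ℝ) - W x) * h x ∂G) :
    ∃ π : Kernel E.Quality E.Ability, IsMarkovKernel π ∧
      (∀ x, ∫ s, (s : ℝ) ∂(π x) = W x) ∧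
      ∀ χ : C(E.Ability, ℝ), ∫ x, ∫ s, ((X x : ℝ) - s) * χ s ∂(π x) ∂G = 0 := by
  classical
  obtain ⟨π, _, hπW, hπX⟩ := E.exists_ratingScheme hX hW hmaj
  have hWm : Measurable W := hW.measurable
  have hA : MeasurableSet {x | ∫ s, (s : ℝ) ∂(π x) = W x} :=
    measurableSet_eq_fun
      (measurable_subtype_coe.stronglyMeasurable.integral_kernel (κ := π)).measurable
      (measurable_subtype_coe.comp hWm)
  refine ⟨Kernel.piecewise hA π (Kernel.deterministic W hWm), inferInstance, fun x => ?_,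
    fun χ => ?_⟩
  · rw [Kernel.piecewise_apply]
    split_ifs with hx
    · exact hx
    · rw [Kernel.deterministic_apply, integral_dirac]
  · refine (integral_congr_ae ?_).trans (hπX χ)
    filter_upwards [hπW] with x hx
    rw [Kernel.piecewise_apply, if_pos (by exact hx)]

variable {m : DirectMechanism E}

/-- A version of `E[θ | q]` with values in the type space. -/
theorem DirectMechanism.exists_condMean (m : DirectMechanism E) :
    ∃ X : E.Quality → E.Ability, Measurable X ∧
      ∀ h : E.Quality → ℝ, Measurable h → ∀ D, (∀ x, ‖h x‖ ≤ D) →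
        ∫ x, (X x : ℝ) * h x ∂(E.F.map m.q) = ∫ θ, (θ : ℝ) * h (m.q θ) ∂E.F := by
  let κ := condDistrib (id : E.Ability → E.Ability) m.q E.F
  refine ⟨fun x => ⟨∫ θ, (θ : ℝ) ∂(κ x),
    E.integral_mem_Icc measurable_subtype_coe fun θ => θ.2⟩, ?_, fun h hh D hD => ?_⟩
  · exact (measurable_subtype_coe.stronglyMeasurable.integral_kernel (κ := κ)).measurable.subtype_mk
  · have hg : Measurable fun z : E.Quality × E.Ability => (z.2 : ℝ) * h z.1 := by fun_prop
    have key := compProd_map_condDistrib (μ := E.F) (X := m.q)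
      (mβ := Subtype.instMeasurableSpace) (Y := (id : E.Ability → E.Ability))
      measurable_id.aemeasurable
    have h1 := integral_map (μ := E.F) (φ := fun θ => (m.q θ, id θ))
      (m.measurable_q.prodMk measurable_id).aemeasurable hg.aestronglyMeasurable
    rw [← key, Measure.integral_compProd] at h1
    · simp only [integral_mul_const, id] at h1
      exact h1
    · have : IsProbabilityMeasure (E.F.map m.q) :=
        Measure.isProbabilityMeasure_map m.measurable_q.aemeasurable
      exact ((E.integrable_of_mem_Icc (measurable_subtype_coe.comp measurable_snd)
        fun z => z.2.2).mul_bdd (hh.comp measurable_fst).aestronglyMeasurable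
          (.of_forall fun z => hD z.1))

/-- If the residual `E[θ | q] - s` is uncorrelated with every function of the score `s`, some
beliefs that obey Bayes' rule assign to each score `s` the mean ability `s`. -/
theorem DirectMechanism.exists_belief {π : Kernel E.Quality E.Ability} [IsMarkovKernel π]
    {X : E.Quality → E.Ability} (hX : ∀ h : E.Quality → ℝ, Measurable h → ∀ D, (∀ x, ‖h x‖ ≤ D) →
        ∫ x, (X x : ℝ) * h x ∂(E.F.map m.q) = ∫ θ, (θ : ℝ) * h (m.q θ) ∂E.F)
    (hXm : Measurable X)
    (hπ : ∀ χ : C(E.Ability, ℝ), ∫ x, ∫ s, ((X x : ℝ) - s) * χ s ∂(π x) ∂(E.F.map m.q) = 0) :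
    ∃ belief : Kernel E.Ability E.Ability, IsMarkovKernel belief ∧ m.BayesConsistent π belief ∧
      ∀ s, marketWage belief s = s := by
  classical
  let J := (E.F.compProd (m.scoreKernel π)).map Prod.swap
  have : IsProbabilityMeasure J := Measure.isProbabilityMeasure_map measurable_swap.aemeasurable
  have hfst : J.fst = E.F.bind (m.scoreKernel π) := by
    rw [Measure.fst_map_swap, Measure.snd_compProd]
  have hB : m.BayesConsistent π J.condKernel := by
    rw [DirectMechanism.BayesConsistent, ← hfst]
    exact (J.disintegrate J.condKernel).symm
  have : IsProbabilityMeasure (E.F.map m.q) :=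
    Measure.isProbabilityMeasure_map m.measurable_q.aemeasurable
  have hae : marketWage J.condKernel =ᵐ[E.F.bind (m.scoreKernel π)] fun s => (s : ℝ) := by
    refine E.ae_eq_of_forall_integral_mul_eq measurable_marketWage measurable_subtype_coe
      marketWage_mem (fun s => s.2) fun ψ => ?_
    have hψ : Measurable ψ := ψ.continuous.measurable
    have hψD : ∀ s, ‖ψ s‖ ≤ ‖ψ‖ := ψ.norm_coe_le_norm
    have hbd {x : ℝ} (hx : x ∈ Set.Icc E.lo E.hi) (s : E.Ability) :
        ‖x * ψ s‖ ≤ max |E.lo| |E.hi| * ‖ψ‖ := by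
      rw [norm_mul]
      exact mul_le_mul (E.norm_ability_le hx) (hψD s) (norm_nonneg _) (by positivity)
    -- Bayes' rule rewrites the tests of ω(s) and of s against ψ as integrals over abilities; these
    -- agree once θ is replaced by E[θ | q].
    have h1 := hB.integral_eq (g := fun z => (z.2 : ℝ) * ψ z.1) (by fun_prop) _
      fun z => hbd z.2.2 z.1
    have h2 := hB.integral_eq (g := fun z => (z.1 : ℝ) * ψ z.1) (by fun_prop) _
      fun z => hbd z.1.2 z.1
    simp only [integral_mul_const, integral_const_mul, integral_const, probReal_univ,
      one_smul] at h1 h2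
    have hΨ : Measurable fun x => ∫ s, ψ s ∂(π x) :=
      (hψ.stronglyMeasurable.integral_kernel (κ := π)).measurable
    have hsψ : Measurable fun x => ∫ s, (s : ℝ) * ψ s ∂(π x) :=
      ((measurable_subtype_coe.mul hψ).stronglyMeasurable.integral_kernel (κ := π)).measurable
    have hΨD (x : E.Quality) : ‖∫ s, ψ s ∂(π x)‖ ≤ ‖ψ‖ := by
      simpa using norm_integral_le_of_norm_le_const (μ := π x) (.of_forall hψD)
    have hsψD (x : E.Quality) : ‖∫ s, (s : ℝ) * ψ s ∂(π x)‖ ≤ max |E.lo| |E.hi| * ‖ψ‖ := by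
      simpa using norm_integral_le_of_norm_le_const (μ := π x)
        (.of_forall fun s : E.Ability => hbd s.2 s)
    have h3 := hX _ hΨ _ hΨD
    have h4 := hπ ψ.toContinuousMap
    have hsi (x : E.Quality) : Integrable (fun s : E.Ability => (s : ℝ) * ψ s) (π x) :=
      .of_bound (measurable_subtype_coe.mul hψ).aestronglyMeasurable _
        (.of_forall fun s => hbd s.2 s)
    have hXr : Integrable (fun x => (X x : ℝ)) (E.F.map m.q) :=
      E.integrable_of_mem_Icc (measurable_subtype_coe.comp hXm) fun x => (X x).2
    have h5 (x : E.Quality) : ∫ s, ((X x : ℝ) - s) * ψ s ∂(π x) =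
        (X x : ℝ) * ∫ s, ψ s ∂(π x) - ∫ s, (s : ℝ) * ψ s ∂(π x) := by
      simp_rw [sub_mul]
      rw [integral_sub ((ψ.integrable (π x)).const_mul _)
        (hsi x), integral_const_mul]
    have h6 : ∫ x, ((X x : ℝ) * ∫ s, ψ s ∂(π x) - ∫ s, (s : ℝ) * ψ s ∂(π x)) ∂(E.F.map m.q) = 0 := by
      simp_rw [← h5]; exact h4
    rw [integral_sub
      (hXr.mul_bdd hΨ.aestronglyMeasurable (.of_forall hΨD))
      (.of_bound hsψ.aestronglyMeasurable _ (.of_forall hsψD)), h3,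
      integral_map m.measurable_q.aemeasurable hsψ.aestronglyMeasurable, h1, h2] at h6
    exact sub_eq_zero.1 h6
  have hA : MeasurableSet {s : E.Ability | marketWage J.condKernel s = s} :=
    measurableSet_eq_fun measurable_marketWage measurable_subtype_coe
  -- On the null set of scores with the wrong mean, the Dirac belief at s is used; Bayes' rule is
  -- unaffected.
  refine ⟨Kernel.piecewise hA J.condKernel Kernel.id, inferInstance, ?_, fun s => ?_⟩
  · refine hB.trans (Measure.compProd_congr ?_)
    filter_upwards [hae] with s hs
    rw [Kernel.piecewise_apply, if_pos (by exact hs)]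
  · rw [marketWage, Kernel.piecewise_apply]
    split_ifs with hs
    · exact hs
    · rw [Kernel.id_apply, integral_dirac]

theorem DirectMechanism.IncentiveCompatible.feasible (hIC : m.IncentiveCompatible) (hM : m.MPS)
    (hBP : m.BP) : m.Feasible := by
  obtain ⟨W, hW, hWw⟩ := hIC.exists_monotone_wage
  obtain ⟨X, hXm, hX⟩ := m.exists_condMean
  have hWm : Measurable W := hW.measurable
  have hw : Measurable m.w := hIC.monotone_w.measurable
  have : IsProbabilityMeasure (E.F.map m.q) :=
    Measure.isProbabilityMeasure_map m.measurable_q.aemeasurable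
  have hmaj (h : E.Quality → ℝ) (hh : Monotone h) (hD : ∃ D, ∀ x, |h x| ≤ D) :
      0 ≤ ∫ x, ((X x : ℝ) - W x) * h x ∂(E.F.map m.q) := by
    obtain ⟨D, hD⟩ := hD
    have hhm : Measurable h := hh.measurable
    have hXr : Measurable fun x => (X x : ℝ) := measurable_subtype_coe.comp hXm
    have hWr : Measurable fun x => (W x : ℝ) := measurable_subtype_coe.comp hWm
    have hi {Ω : Type} [MeasurableSpace Ω] {μ : Measure Ω} [IsFiniteMeasure μ] {Y k : Ω → ℝ}
        (hY : Measurable Y) (hY' : ∀ x, Y x ∈ Set.Icc E.lo E.hi) (hk : Measurable k)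
        (hk' : ∀ x, ‖k x‖ ≤ D) : Integrable (fun x => Y x * k x) μ :=
      (E.integrable_of_mem_Icc hY hY').mul_bdd hk.aestronglyMeasurable (.of_forall hk')
    have hWhm : Measurable fun x => (W x : ℝ) * h x := hWr.mul hhm
    -- The test function is h ∘ q, monotone in ability; its integral is then pushed forward to the
    -- law of quality.
    have h1 := integral_sub_mul_nonneg hw hM hBP (hh.comp hIC.monotone_q) D fun θ => hD _
    simp_rw [sub_mul] at h1 ⊢
    rw [integral_sub (hi hXr (fun x => (X x).2) hhm hD)
      (hi hWr (fun x => (W x).2) hhm hD), hX h hhm D hD,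
      integral_map m.measurable_q.aemeasurable hWhm.aestronglyMeasurable]
    rw [integral_sub (hi measurable_subtype_coe (fun θ => θ.2) (hhm.comp m.measurable_q)
      fun θ => hD _) (hi hw m.w_mem (hhm.comp m.measurable_q) fun θ => hD _)] at h1
    simpa only [hWw, Function.comp_apply] using h1
  obtain ⟨π, _, hπW, hπX⟩ := Env.exists_ratingScheme_forall hXm hW hmaj
  obtain ⟨belief, hbelief, hB, hmean⟩ := DirectMechanism.exists_belief hX hXm hπX
  refine ⟨E.Ability, inferInstance, π, belief, inferInstance, hbelief, hB, fun θ => ?_⟩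
  simp_rw [hmean]
  rw [hπW, hWw]

end Sufficiency

end AbilitySignaling

theorem mainTheorem10 (E : AbilitySignaling.Env) (m : AbilitySignaling.DirectMechanism E)
    (hIC : m.IncentiveCompatible) :
    m.Feasible ↔ (m.MPS ∧ m.BP) :=
  ⟨fun h => h.mps_and_bp, fun h => hIC.feasible h.1 h.2⟩
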